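/- **Setting.** Let $T>0$, let $K\subset\mathbb{R}^M$ be the closure of a bounded open set and have smooth boundary, let $x_o\in\mathbb{R}^{N}$, let $f=(f^i):[0,T]\times\mathbb{R}^{N}\times K\to\mathbb{R}^{N}$ and $C:\mathbb{R}^{N}\to\mathbb{R}$ be smooth. On curves $q(t)=(x(t),p(t))\in\mathbb{R}^{2N}$, $t\in[0,T]$, consider the controlled Lagrangian $$L(t,q,\dot q,u)=\sum_{i=1}^N p_i\big(\dot x^i-f^i(t,x,u)\big),$$ whose Euler–Lagrange equations are $\dot x^i=f^i(t,x,u(t))$, $\dot p_i=-\sum_\ell p_\ell\,\frac{\partial f^\ell}{\partial x^i}(t,x,u(t))$. Let $\mathscr K$ be the set of pairs $U=(u,\sigma)$ where $u:[0,T]\to K$ is a smooth curve and $\sigma=(x(0),p(0))$ is an initial datum with $x(0)=x_o$ and $p(0)\in\mathbb{R}^N$ arbitrary. Assume that for each $U\in\mathscr K$ the Euler–Lagrange equations of $L$ with control $u$ and initial datum $\sigma$ have a unique solution $\gamma^{(U)}$ on the whole of $[0,T]$; these solutions are called $\mathscr K$-controlled curves. A $\mathscr K$-controlled curve is a *solution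 to the Mayer problem* determined by $(\mathscr K,L,C)$ if its terminal cost $C(x(T))$ is minimal among the terminal costs of all $\mathscr K$-controlled curves. Put $$\mathscr H(t,x,p)(\omega)=\sum_{i=1}^N p_i f^i(t,x,\omega),\qquad \omega\in K.$$ **Corollary (Pontryagin Maximum Principle).** Let $\gamma_o=\gamma^{(U_o)}$, $U_o=(u_o,\sigma_o)\in\mathscr K$, with components $(x(t),p(t))$, be a $\mathscr K$-controlled curve with $p_i(T)=-\frac{\partial C}{\partial x^i}\big|_{x(T)}$ for all $i$. If $\gamma_o$ is a solution to the Mayer problem, then for every $\tau\in(0,T]$ and every $\omega\in K$ in the same connected component of $K$ as $u_o(\tau)$ (that is, every $\omega\in K$ if $K$ is connected) $$\mathscr H(\tau,x(\tau),p(\tau))(\omega)\;\le\;\mathscr H(\tau,x(\tau),p(\tau))(u_o(\tau)).$$ -/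

import Mathlib

open Set
open scoped ContDiff

namespace Mayer

/-- Coordinates `(q_(0), …, q_(n))` of the `n`-jets (at a given time) of curves in `ℝ^ι`. -/
abbrev Jet (n : ℕ) (ι : Type) : Type := Fin (n + 1) → ι → ℝ

/-- The `n`-jet at time `t` of a curve `γ` defined on `[0, T]` (one-sided derivatives are used
at the two end points). -/
noncomputable def jetLift {ι : Type} [Fintype ι] (T : ℝ) (n : ℕ) (γ : ℝ → ι → ℝ) (t : ℝ) :
    Jet n ι :=
  fun β => iteratedDerivWithin (β : ℕ) γ (Icc 0 T) t

/-- The partial derivative `∂F/∂q^i_(β)` of a function `F(t, q_(0), …, q_(n), u)`. -/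
noncomputable def jetPartial {n : ℕ} {ι V : Type} [DecidableEq ι]
    (F : ℝ → Jet n ι → V → ℝ) (β : Fin (n + 1)) (i : ι) : ℝ → Jet n ι → V → ℝ :=
  fun t j u => lineDeriv ℝ (fun j' : Jet n ι => F t j' u) j (Pi.single β (Pi.single i 1))

/-- The total derivative `dF/dt = ∂F/∂t + ∑_{δ, i} ∂F/∂q^i_(δ) q^i_(δ+1)` of a function on
`n`-jets whose actual order is at most `n - 1`; the control `u` is treated as a constant. -/
noncomputable def totalDeriv {n : ℕ} {ι V : Type} [Fintype ι] [DecidableEq ι]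
    (F : ℝ → Jet n ι → V → ℝ) : ℝ → Jet n ι → V → ℝ :=
  fun t j u => deriv (fun s => F s j u) t
    + ∑ δ : Fin n, ∑ i : ι, jetPartial F δ.castSucc i t j u * j δ.succ i

/-- The controlled Euler-Lagrange operator
`E_i(L) = ∂L/∂q^i + ∑_{β=1}^r (-1)^β (d/dt)^β (∂L/∂q^i_(β))`
on controlled Lagrangians of actual order `r`. -/
noncomputable def eulerLagrange {n : ℕ} {ι V : Type} [Fintype ι] [DecidableEq ι] (r : ℕ)
    (L : ℝ → Jet n ι → V → ℝ) (i : ι) : ℝ → Jet n ι → V → ℝ :=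
  fun t j u => jetPartial L 0 i t j u
    + ∑ β ∈ Finset.univ.filter (fun β : Fin (n + 1) => 1 ≤ β.val ∧ β.val ≤ r),
        (-1 : ℝ) ^ β.val * (totalDeriv^[β.val] (jetPartial L β i)) t j u

/-- The data `(𝒦, L, C)` of a generalised Mayer problem on `n`-jets of curves in `ℝ^ι` with
control values in `V`: a set `𝒦` of pairs `(u, σ)` of a control curve and a `k`-jet of initial
data, a controlled Lagrangian `L` and a cost function `C`. -/
structure Triple (n k : ℕ) (ι V : Type) where
  controls : Set ((ℝ → V) × Jet k ι)
  lagrangian : ℝ → Jet n ι → V → ℝ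
  cost : ℝ → Jet n ι → ℝ

/-- `γ` is, on `[0, T]`, a solution to the controlled Euler-Lagrange equations of order `2r`
given by the control curve `u = U.1`, with initial jet `σ = U.2`. -/
structure IsControlledCurve {n k : ℕ} {ι V : Type} [Fintype ι] [DecidableEq ι]
    (T : ℝ) (r : ℕ) (D : Triple n k ι V) (U : (ℝ → V) × Jet k ι) (γ : ℝ → ι → ℝ) : Prop where
  contDiffOn : ContDiffOn ℝ n γ (Icc 0 T)
  initial : jetLift T k γ 0 = U.2
  equations : ∀ t ∈ Icc 0 T, ∀ i : ι,
    eulerLagrange r D.lagrangian i t (jetLift T n γ t) (U.1 t) = 0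

/-- Every `U ∈ 𝒦` determines one and only one `𝒦`-controlled curve `γ^(U)` on `[0, T]`. -/
def WellPosed {n k : ℕ} {ι V : Type} [Fintype ι] [DecidableEq ι]
    (T : ℝ) (r : ℕ) (D : Triple n k ι V) : Prop :=
  ∀ U ∈ D.controls, ∃ γ : ℝ → ι → ℝ, IsControlledCurve T r D U γ ∧
    ∀ γ' : ℝ → ι → ℝ, IsControlledCurve T r D U γ' → EqOn γ' γ (Icc 0 T)

/-- The `𝒦`-controlled curve `γ = γ^(U)` is a solution to the generalised Mayer problem: its
terminal cost is minimal among those of all `𝒦`-controlled curves. -/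
def IsSolution {n k : ℕ} {ι V : Type} [Fintype ι] [DecidableEq ι]
    (T : ℝ) (r : ℕ) (D : Triple n k ι V) (U : (ℝ → V) × Jet k ι) (γ : ℝ → ι → ℝ) : Prop :=
  (U ∈ D.controls ∧ IsControlledCurve T r D U γ) ∧
    ∀ U' ∈ D.controls, ∀ γ' : ℝ → ι → ℝ, IsControlledCurve T r D U' γ' →
      D.cost T (jetLift T n γ T) ≤ D.cost T (jetLift T n γ' T)

/-- `K` is the closure of a bounded open subset of `ℝ^M` and its boundary is smooth: near each
boundary point `K` is a sublevel set of a smooth function with non-vanishing differential. -/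
structure IsSmoothRegion {M : ℕ} (K : Set (Fin M → ℝ)) : Prop where
  closure_open : ∃ Ω : Set (Fin M → ℝ), IsOpen Ω ∧ Bornology.IsBounded Ω ∧ K = closure Ω
  smooth_boundary : ∀ a ∈ frontier K, ∃ (V : Set (Fin M → ℝ)) (ρ : (Fin M → ℝ) → ℝ),
    IsOpen V ∧ a ∈ V ∧ ContDiffOn ℝ ∞ ρ V ∧ fderiv ℝ ρ a ≠ 0 ∧ K ∩ V = {z ∈ V | ρ z ≤ 0}

/-- The state part `x` of a point `q = (x, p)`. -/
def statePart {N : ℕ} (q : Fin N ⊕ Fin N → ℝ) : Fin N → ℝ := fun i => q (Sum.inl i)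

/-- The auxiliary part `p` of a point `q = (x, p)`. -/
def costatePart {N : ℕ} (q : Fin N ⊕ Fin N → ℝ) : Fin N → ℝ := fun i => q (Sum.inr i)

/-- The triple of the classical Mayer problem `dx/dt = f(t, x, u)`, `x(0) = x₀`, with terminal
cost `C(x(T))`: it lives on the `3`-jets of the curves `q = (x, p)`, the controls are the smooth
`u : [0, T] → K`, the initial data are the `(x(0), p(0))` with `x(0) = x₀` and `p(0)`
unconstrained, and `L = p_i (x^i_(1) - f^i(t, x, u))`. -/
def classicalTriple {N M : ℕ} (T : ℝ) (K : Set (Fin M → ℝ)) (x₀ : Fin N → ℝ)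
    (f : ℝ → (Fin N → ℝ) → (Fin M → ℝ) → (Fin N → ℝ)) (C : (Fin N → ℝ) → ℝ) :
    Triple 3 0 (Fin N ⊕ Fin N) (Fin M → ℝ) where
  controls := {U | ContDiffOn ℝ ∞ U.1 (Icc 0 T) ∧ MapsTo U.1 (Icc 0 T) K ∧
    statePart (U.2 0) = x₀}
  lagrangian := fun t j u =>
    ∑ i : Fin N, costatePart (j 0) i * (statePart (j 1) i - f t (statePart (j 0)) u i)
  cost := fun _ j => C (statePart (j 0))

/-- The classical Pontryagin function `H(t, x, p)(w) = ∑ p_i f^i(t, x, w)`. -/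
def pontryagin {N M : ℕ} (f : ℝ → (Fin N → ℝ) → (Fin M → ℝ) → (Fin N → ℝ))
    (t : ℝ) (x p : Fin N → ℝ) (w : Fin M → ℝ) : ℝ :=
  ∑ i : Fin N, p i * f t x w i

end Mayer

namespace Mayer

/-! ### Smooth paths inside a set -/

/-! For this Lagrangian the Euler–Lagrange equations are the state equation and its adjoint
equation, so the costate defines a covector `ℓ` solving the equation dual to the linearised state
equation, with `ℓ T = -dC`. Suppose that at an interior time `τ` the value `w` gives the Pontryagin
function an excess `Δ > 0` over `u τ`. Let the control take the value `w` during a time of order `ε`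
around `τ`, and let `y` be the resulting displacement of the state. Gronwall gives `y = O(ε)`
(`norm_le_of_window`). By the adjoint equation the part of `d/dt ℓ(y)` linear in `y` cancels
(`hasDerivWithinAt_pairing`). Hence the rate is `o(ε)` where the control is unchanged and close to
`Δ` where it equals `w`. So `ℓ T (y T)` is at least a positive multiple of `Δ ε`, the cost drops to
first order, and optimality is contradicted (`le_of_needle_variations`).

Since admissible controls are smooth, the needle has to move inside `K` from `u τ` to `w` and back.
The smooth boundary of `K` provides a smooth path within the connected component
(`IsSmoothRegion.exists_isSmoothPathIn`). The two transitions last `(1 - κ) ε` each, so their effect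
is negligible against the gain once `κ` is close to `1`. The time `τ = T` follows by continuity. -/

/-- A smooth path in `K` from `a` to `b` which is constant outside of `[0, 1]`. -/
structure IsSmoothPathIn {V : Type*} [NormedAddCommGroup V] [NormedSpace ℝ V] (K : Set V)
    (a b : V) (c : ℝ → V) : Prop where
  contDiff : ContDiff ℝ ∞ c
  mem : ∀ s, c s ∈ K
  left : ∀ s ≤ 0, c s = a
  right : ∀ s, 1 ≤ s → c s = b

/-! ### Needle variations -/

section Needle

/-- A smooth reparametrisation of time that stops at `τ` while `|t - τ| ≤ ε` and is the identity
when `|t - τ| ≥ 2 ε`. -/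
noncomputable def stoppedTime (τ ε t : ℝ) : ℝ :=
  τ + (t - τ) * Real.smoothTransition (((t - τ) / ε) ^ 2 - 1)

lemma contDiff_stoppedTime (τ ε : ℝ) : ContDiff ℝ ∞ (stoppedTime τ ε) := by
  unfold stoppedTime
  have h : ContDiff ℝ ∞ (fun t : ℝ => ((t - τ) / ε) ^ 2 - 1) := by fun_prop
  have h2 := (Real.smoothTransition.contDiff (n := ⊤)).comp h
  exact contDiff_const.add ((contDiff_id.sub contDiff_const).mul h2)

lemma stoppedTime_of_le {τ ε t : ℝ} (hε : 0 < ε) (h : |t - τ| ≤ ε) : stoppedTime τ ε t = τ := by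
  have : ((t - τ) / ε) ^ 2 ≤ 1 := by
    rw [sq_le_one_iff_abs_le_one, abs_div, abs_of_pos hε]
    exact (div_le_one hε).2 h
  rw [stoppedTime, Real.smoothTransition.zero_of_nonpos (by linarith)]
  ring

lemma stoppedTime_of_ge {τ ε t : ℝ} (hε : 0 < ε) (h : 2 * ε ≤ |t - τ|) :
    stoppedTime τ ε t = t := by
  have : 2 ^ 2 ≤ ((t - τ) / ε) ^ 2 := by
    rw [sq_le_sq, abs_div, abs_of_pos hε, le_div_iff₀ hε, abs_of_pos (by norm_num)]
    exact h
  rw [stoppedTime, Real.smoothTransition.one_of_one_le (by linarith)]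
  ring

lemma abs_stoppedTime_sub_le (τ ε t : ℝ) : |stoppedTime τ ε t - τ| ≤ |t - τ| := by
  rw [stoppedTime, add_sub_cancel_left, abs_mul,
    abs_of_nonneg (Real.smoothTransition.nonneg _)]
  exact mul_le_of_le_one_right (abs_nonneg _) (Real.smoothTransition.le_one _)

lemma stoppedTime_mem {s : Set ℝ} (hs : Convex ℝ s) {τ t : ℝ} (hτ : τ ∈ s) (ht : t ∈ s) (ε : ℝ) :
    stoppedTime τ ε t ∈ s := by
  have h := hs.add_smul_sub_mem hτ ht (t := Real.smoothTransition (((t - τ) / ε) ^ 2 - 1))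
    ⟨Real.smoothTransition.nonneg _, Real.smoothTransition.le_one _⟩
  rwa [smul_eq_mul, mul_comm] at h

variable {V : Type*} [NormedAddCommGroup V] [NormedSpace ℝ V]

/-- The control `u`, modified in the window `|t - τ| ≤ 2 ε` so as to run, along the path `c`, from
`u τ` to the end point of `c`, stay there while `|t - τ| ≤ κ ε`, and come back. -/
noncomputable def needleControl (u c : ℝ → V) (τ ε κ t : ℝ) : V :=
  u (stoppedTime τ ε t) + (c ((1 - ((t - τ) / ε) ^ 2) / (1 - κ ^ 2)) - u τ)

variable {K : Set V} {u c : ℝ → V} {w : V} {τ ε κ t : ℝ}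

lemma contDiffOn_needleControl {s : Set ℝ} (hs : Convex ℝ s) (hτ : τ ∈ s)
    (hu : ContDiffOn ℝ ∞ u s) (hc : ContDiff ℝ ∞ c) :
    ContDiffOn ℝ ∞ (needleControl u c τ ε κ) s := by
  unfold needleControl
  have h1 : ContDiffOn ℝ ∞ (fun t => u (stoppedTime τ ε t)) s :=
    hu.comp (contDiff_stoppedTime τ ε).contDiffOn fun t ht => stoppedTime_mem hs hτ ht ε
  have h2 : ContDiff ℝ ∞ (fun t : ℝ => (1 - ((t - τ) / ε) ^ 2) / (1 - κ ^ 2)) := by fun_prop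
  exact h1.add (((hc.comp h2).sub contDiff_const).contDiffOn)

lemma needleControl_of_ge (hc : IsSmoothPathIn K (u τ) w c) (hε : 0 < ε) (hκ : κ ^ 2 < 1)
    (h : ε ≤ |t - τ|) : needleControl u c τ ε κ t = u (stoppedTime τ ε t) := by
  have : 1 ≤ ((t - τ) / ε) ^ 2 := by
    rw [one_le_sq_iff_one_le_abs, abs_div, abs_of_pos hε, le_div_iff₀ hε, one_mul]
    exact h
  rw [needleControl, hc.left _ (div_nonpos_of_nonpos_of_nonneg (by linarith) (by linarith)),
    sub_self, add_zero]

set_option linter.unusedSectionVars false in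
lemma needleControl_of_le (hε : 0 < ε) (h : |t - τ| ≤ ε) :
    needleControl u c τ ε κ t = c ((1 - ((t - τ) / ε) ^ 2) / (1 - κ ^ 2)) := by
  rw [needleControl, stoppedTime_of_le hε h]
  abel

lemma needleControl_of_far (hc : IsSmoothPathIn K (u τ) w c) (hε : 0 < ε) (hκ : κ ^ 2 < 1)
    (h : 2 * ε ≤ |t - τ|) : needleControl u c τ ε κ t = u t := by
  rw [needleControl_of_ge hc hε hκ (by linarith), stoppedTime_of_ge hε h]

lemma needleControl_of_near (hc : IsSmoothPathIn K (u τ) w c) (hε : 0 < ε) (hκ0 : 0 ≤ κ)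
    (hκ : κ < 1) (h : |t - τ| ≤ κ * ε) : needleControl u c τ ε κ t = w := by
  have h1 : |t - τ| ≤ ε := h.trans (mul_le_of_le_one_left hε.le hκ.le)
  have h2 : ((t - τ) / ε) ^ 2 ≤ κ ^ 2 := by
    rw [sq_le_sq, abs_div, abs_of_pos hε, abs_of_nonneg hκ0, div_le_iff₀ hε]
    exact h
  have h3 : κ ^ 2 < 1 := by nlinarith
  rw [needleControl_of_le hε h1, hc.right]
  rw [le_div_iff₀ (by linarith)]
  linarith

/-- Although the needle is a sum, one summand always cancels `u τ`: for `|t - τ| ≤ ε` time is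
stopped and only `c` remains, and beyond that `c` rests at its start and only `u` remains. -/
lemma needleControl_mem {s : Set ℝ} (hs : Convex ℝ s) (hτ : τ ∈ s) (hu : MapsTo u s K)
    (hc : IsSmoothPathIn K (u τ) w c) (hε : 0 < ε) (hκ : κ ^ 2 < 1) (ht : t ∈ s) :
    needleControl u c τ ε κ t ∈ K := by
  rcases le_total (|t - τ|) ε with h | h
  · rw [needleControl_of_le hε h]
    exact hc.mem _
  · rw [needleControl_of_ge hc hε hκ h]
    exact hu (stoppedTime_mem hs hτ ht ε)

end Needle

/-! ### Growth estimates -/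

lemma mul_sub_le_sub_of_le_derivWithin {T a b m : ℝ} {g g' : ℝ → ℝ}
    (hg : ∀ t ∈ Icc 0 T, HasDerivWithinAt g (g' t) (Icc 0 T) t) (ha : 0 ≤ a) (hab : a ≤ b)
    (hb : b ≤ T) (hm : ∀ t ∈ Ioo a b, m ≤ g' t) : m * (b - a) ≤ g b - g a := by
  have hd : ∀ t ∈ Ioo a b, HasDerivAt g (g' t) t := fun t ht =>
    (hg t ⟨ha.trans ht.1.le, ht.2.le.trans hb⟩).hasDerivAt
      (Icc_mem_nhds (ha.trans_lt ht.1) (ht.2.trans_le hb))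
  refine (convex_Icc a b).mul_sub_le_image_sub_of_le_deriv (f := g) ?_ ?_ ?_ a
    (left_mem_Icc.2 hab) b (right_mem_Icc.2 hab) hab
  · exact fun t ht => ((hg t ⟨ha.trans ht.1, ht.2.trans hb⟩).mono
      (Icc_subset_Icc ha hb)).continuousWithinAt
  · rw [interior_Icc]
    exact fun t ht => (hd t ht).differentiableAt.differentiableWithinAt
  · rw [interior_Icc]
    intro t ht
    rw [(hd t ht).deriv]
    exact hm t ht

/-- A Gronwall estimate for a curve that starts at `0` and whose equation is perturbed, by a bounded
amount, only in a short window around `τ`; the bounds are needed only inside of the unit ball. -/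
lemma norm_le_of_window {E : Type*} [NormedAddCommGroup E] [NormedSpace ℝ E] {T τ ε L B : ℝ}
    {y y' : ℝ → E} (hε : 0 < ε) (hL : 0 ≤ L) (hB : 0 ≤ B) (hy0 : y 0 = 0)
    (hy : ∀ t ∈ Icc 0 T, HasDerivWithinAt y (y' t) (Icc 0 T) t)
    (hwin : ∀ t ∈ Icc 0 T, ‖y t‖ ≤ 1 → |t - τ| ≤ 2 * ε → ‖y' t‖ ≤ B)
    (hout : ∀ t ∈ Icc 0 T, ‖y t‖ ≤ 1 → 2 * ε ≤ |t - τ| → ‖y' t‖ ≤ L * ‖y t‖)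
    (hsmall : (4 * (5 * B + 1) * Real.exp ((L + 1) * T)) * ε ≤ 1) :
    ∀ t ∈ Icc 0 T, ‖y t‖ ≤ (4 * (5 * B + 1) * Real.exp ((L + 1) * T)) * ε := by
  -- The barrier is an exponential times a bounded factor that climbs in the window: the slope of
  -- the arctangent is at least `1 / (5 ε)` for `|t - τ| ≤ 2 ε`, which beats `B` thanks to the
  -- factor `ε (5 B + 1)`. Outside, the rate `L + 1` beats `L` strictly.
  set a : ℝ → ℝ := fun t => 2 + Real.arctan ((t - τ) / ε) with ha
  have ha0 : ∀ t, 0 < a t := fun t => by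
    have := Real.neg_pi_div_two_lt_arctan ((t - τ) / ε)
    have := Real.pi_le_four
    simp only [ha]; linarith
  have ha4 : ∀ t, a t ≤ 4 := fun t => by
    have := Real.arctan_lt_pi_div_two ((t - τ) / ε)
    have := Real.pi_le_four
    simp only [ha]; linarith
  set b : ℝ → ℝ := fun t => Real.exp ((L + 1) * t) * (ε * (5 * B + 1) * a t) with hb
  set b' : ℝ → ℝ := fun t => Real.exp ((L + 1) * t) * (L + 1) * (ε * (5 * B + 1) * a t)
    + Real.exp ((L + 1) * t) * (ε * (5 * B + 1) * (1 / (1 + ((t - τ) / ε) ^ 2) * (1 / ε))) with hb'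
  have hbd : ∀ t, HasDerivAt b (b' t) t := fun t => by
    have h1 : HasDerivAt (fun t : ℝ => Real.exp ((L + 1) * t))
        (Real.exp ((L + 1) * t) * (L + 1)) t := by
      have := ((hasDerivAt_id t).const_mul (L + 1)).exp
      simpa using this
    have h2 : HasDerivAt a (1 / (1 + ((t - τ) / ε) ^ 2) * (1 / ε)) t :=
      ((((hasDerivAt_id t).sub_const τ).div_const ε).arctan).const_add 2
    exact h1.mul (h2.const_mul _)
  have hbpos : ∀ t, 0 < b t := fun t => by have := ha0 t; positivity
  have hble : ∀ t ∈ Icc 0 T, b t ≤ (4 * (5 * B + 1) * Real.exp ((L + 1) * T)) * ε := by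
    intro t ht
    have h1 : Real.exp ((L + 1) * t) ≤ Real.exp ((L + 1) * T) :=
      Real.exp_le_exp.2 (mul_le_mul_of_nonneg_left ht.2 (by linarith))
    calc b t ≤ Real.exp ((L + 1) * T) * (ε * (5 * B + 1) * 4) := by
          have := ha0 t
          have := ha4 t
          simp only [hb]
          gcongr
      _ = _ := by ring
  -- The strict inequality of slopes is only required where `‖y t‖ = b t`. There `hsmall` puts `y t`
  -- in the unit ball, so the local bounds apply.
  have key := image_norm_le_of_norm_deriv_right_lt_deriv_boundary' (f := y) (f' := y') (a := 0)
    (b := T) (B := b) (B' := b') (fun t ht => (hy t ht).continuousWithinAt)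
    (fun t ht => (hy t ⟨ht.1, ht.2.le⟩).mono_of_mem_nhdsWithin
      (Icc_mem_nhdsGE_of_mem ht)) (by rw [hy0, norm_zero]; exact (hbpos 0).le)
    (fun t _ => (hbd t).continuousAt.continuousWithinAt)
    (fun t _ => (hbd t).hasDerivWithinAt) ?_
  · exact fun t ht => (key ht).trans (hble t ht)
  intro t ht hyb
  have ht' : t ∈ Icc 0 T := ⟨ht.1, ht.2.le⟩
  have hy1 : ‖y t‖ ≤ 1 := by rw [hyb]; exact (hble t ht').trans hsmall
  have hsplit : b' t = (L + 1) * b t + Real.exp ((L + 1) * t) * (5 * B + 1)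
      * (1 / (1 + ((t - τ) / ε) ^ 2)) := by
    simp only [hb, hb']
    field_simp
  rw [hsplit]
  have hpos := hbpos t
  rcases le_total (|t - τ|) (2 * ε) with h | h
  · have h2 : ((t - τ) / ε) ^ 2 ≤ 2 ^ 2 := by
      rw [sq_le_sq, abs_div, abs_of_pos hε, abs_of_pos (by norm_num : (0 : ℝ) < 2),
        div_le_iff₀ hε]
      exact h
    have h3 : (1 / 5 : ℝ) ≤ 1 / (1 + ((t - τ) / ε) ^ 2) :=
      one_div_le_one_div_of_le (by positivity) (by linarith)
    have h4 : 1 ≤ Real.exp ((L + 1) * t) := Real.one_le_exp (mul_nonneg (by linarith) ht.1)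
    have h5 : 1 * (5 * B + 1) * (1 / 5) ≤ Real.exp ((L + 1) * t) * (5 * B + 1)
        * (1 / (1 + ((t - τ) / ε) ^ 2)) := by gcongr
    have := hwin t ht' hy1 h
    nlinarith
  · have h5 : 0 ≤ Real.exp ((L + 1) * t) * (5 * B + 1) * (1 / (1 + ((t - τ) / ε) ^ 2)) := by
      positivity
    have := hout t ht' hy1 h
    rw [hyb] at this
    nlinarith

end Mayer

namespace Mayer

/-! ### Smooth path-connectedness of the components of a smooth region -/

section Paths

variable {V : Type*} [NormedAddCommGroup V] [NormedSpace ℝ V] {K : Set V} {a b d : V} {c c' : ℝ → V}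

lemma IsSmoothPathIn.symm (h : IsSmoothPathIn K a b c) :
    IsSmoothPathIn K b a (fun s => c (1 - s)) where
  contDiff := h.contDiff.comp (contDiff_const.sub contDiff_id)
  mem _ := h.mem _
  left _ hs := h.right _ (by linarith)
  right _ hs := h.left _ (by linarith)

/-- Both paths are constant outside `[0, 1]`, so at each time one of the two is at `b`. Writing the
concatenation as a sum makes smoothness immediate. -/
lemma IsSmoothPathIn.trans (h : IsSmoothPathIn K a b c) (h' : IsSmoothPathIn K b d c') :
    IsSmoothPathIn K a d (fun s => c (2 * s) + (c' (2 * s - 1) - b)) where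
  contDiff := by
    have h1 : ContDiff ℝ ∞ (fun s : ℝ => 2 * s) := by fun_prop
    have h2 : ContDiff ℝ ∞ (fun s : ℝ => 2 * s - 1) := by fun_prop
    exact (h.contDiff.comp h1).add ((h'.contDiff.comp h2).sub contDiff_const)
  mem s := by
    rcases le_total (2 * s) 1 with hs | hs
    · rw [h'.left _ (by linarith), sub_self, add_zero]
      exact h.mem _
    · rw [h.right _ hs, add_sub_cancel]
      exact h'.mem _
  left s hs := by rw [h'.left _ (by linarith), sub_self, add_zero, h.left _ (by linarith)]
  right s hs := by rw [h.right _ (by linarith), add_sub_cancel, h'.right _ (by linarith)]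

lemma isSmoothPathIn_of_segment_subset (h : segment ℝ a b ⊆ K) :
    IsSmoothPathIn K a b (fun s => a + Real.smoothTransition s • (b - a)) where
  contDiff := contDiff_const.add
    ((Real.smoothTransition.contDiff (n := ⊤)).smul contDiff_const)
  mem s := by
    apply h
    rw [segment_eq_image']
    exact ⟨_, ⟨Real.smoothTransition.nonneg _, Real.smoothTransition.le_one _⟩, rfl⟩
  left s hs := by rw [Real.smoothTransition.zero_of_nonpos hs, zero_smul, add_zero]
  right s hs := by rw [Real.smoothTransition.one_of_one_le hs, one_smul, add_sub_cancel]

/-- Near a point where `K` is a regular sublevel set, all points of `K` can be reached from that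
point by a smooth path in `K`: enter `K` transversally, go straight on, and come back. -/
lemma eventually_isSmoothPathIn_of_sublevel {W : Set V} {ρ : V → ℝ} (hW : IsOpen W) (haW : a ∈ W)
    (haK : a ∈ K) (hρ : ContDiffOn ℝ ∞ ρ W) (hρa : fderiv ℝ ρ a ≠ 0)
    (hKW : K ∩ W = {z ∈ W | ρ z ≤ 0}) : ∀ᶠ z in nhdsWithin a K, ∃ c, IsSmoothPathIn K a z c := by
  have hcd : ContDiffAt ℝ ∞ ρ a := hρ.contDiffAt (hW.mem_nhds haW)
  have hstrict : HasStrictFDerivAt ρ (fderiv ℝ ρ a) a :=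
    hcd.hasStrictFDerivAt (by simp)
  obtain ⟨v₁, hv₁⟩ : ∃ v, fderiv ℝ ρ a v ≠ 0 := by
    by_contra! h
    exact hρa (ContinuousLinearMap.ext h)
  -- `v` points into `K`; with the choice of `η` below, moving by `t • v` lowers `ρ` by at least `t
  -- / 2`.
  obtain ⟨v, hv⟩ : ∃ v, fderiv ℝ ρ a v = -1 :=
    ⟨(-(fderiv ℝ ρ a v₁)⁻¹) • v₁, by simp [hv₁]⟩
  set φ := fderiv ℝ ρ a with hφ
  set η : ℝ := 1 / (2 * (‖v‖ + 1)) with hη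
  have hη0 : 0 < η := by positivity
  have hηv : η * ‖v‖ ≤ 1 / 2 := by
    rw [hη, one_div, inv_mul_le_iff₀ (by positivity)]
    linarith
  obtain ⟨r, hr, hball⟩ : ∃ r > 0, ∀ y ∈ Metric.ball a r, ∀ z ∈ Metric.ball a r,
      y ∈ W ∧ |ρ y - ρ z - φ (y - z)| ≤ η * ‖y - z‖ := by
    have h1 := hstrict.isLittleO.def hη0
    rw [nhds_prod_eq] at h1
    have h2 : ∀ᶠ p in (nhds a ×ˢ nhds a : Filter (V × V)), p.1 ∈ W :=
      Filter.tendsto_fst.eventually (hW.eventually_mem haW)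
    obtain ⟨r, hr, h⟩ := ((Metric.nhds_basis_ball (x := a)).prod_self).eventually_iff.1 (h1.and h2)
    exact ⟨r, hr, fun y hy z hz => ⟨(h (x := (y, z)) ⟨hy, hz⟩).2, (h (x := (y, z)) ⟨hy, hz⟩).1⟩⟩
  set s : ℝ := r / (2 * (‖v‖ + 1)) with hs
  have hs0 : 0 < s := by positivity
  have hsv : s * ‖v‖ ≤ r / 2 := by
    have : s * (‖v‖ + 1) = r / 2 := by rw [hs]; field_simp
    nlinarith
  -- So small that the descent `s / 2` along `s • v` outweighs the variation of `ρ` over the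
  -- translated `δ`-ball, which therefore lies in `K`.
  set δ : ℝ := min (r / 2) (s / (2 * (‖φ‖ + η + 1))) with hδ
  have hδ0 : 0 < δ := by positivity
  have hδs : (‖φ‖ + η) * δ ≤ s / 2 := by
    have h1 : δ ≤ s / (2 * (‖φ‖ + η + 1)) := min_le_right _ _
    rw [le_div_iff₀ (by positivity)] at h1
    nlinarith
  have memball : ∀ z, ‖z - a‖ < δ → ∀ t ∈ Icc (0 : ℝ) s, z + t • v ∈ Metric.ball a r := by
    intro z hz t ht
    have h1 : ‖t • v‖ ≤ r / 2 := by
      rw [norm_smul, Real.norm_of_nonneg ht.1]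
      exact (mul_le_mul_of_nonneg_right ht.2 (norm_nonneg _)).trans hsv
    have h2 : δ ≤ r / 2 := min_le_left _ _
    rw [mem_ball_iff_norm]
    calc ‖z + t • v - a‖ = ‖(z - a) + t • v‖ := by congr 1; abel
      _ ≤ ‖z - a‖ + ‖t • v‖ := norm_add_le _ _
      _ < r := by linarith
  have descend : ∀ z, ‖z - a‖ < δ → ∀ t ∈ Icc (0 : ℝ) s, ρ (z + t • v) ≤ ρ z - t / 2 := by
    intro z hz t ht
    have h0 := memball z hz 0 ⟨le_rfl, hs0.le⟩
    rw [zero_smul, add_zero] at h0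
    have h1 := (hball _ (memball z hz t ht) z h0).2
    rw [add_sub_cancel_left, map_smul, hv, norm_smul, Real.norm_of_nonneg ht.1] at h1
    have h2 := (abs_le.1 h1).2
    have h3 : t * (η * ‖v‖) ≤ t * (1 / 2) := mul_le_mul_of_nonneg_left hηv ht.1
    simp only [smul_eq_mul] at h2
    linarith
  have ha0 : ρ a ≤ 0 := (hKW.subset ⟨haK, haW⟩).2
  have hnear : ∀ z, ‖z - a‖ < δ → ρ (z + s • v) ≤ 0 := by
    intro z hz
    have h0 := memball z hz s ⟨hs0.le, le_rfl⟩
    have h0' := memball a (by simpa using hδ0) s ⟨hs0.le, le_rfl⟩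
    have h1 := (hball _ h0 _ h0').2
    rw [add_sub_add_right_eq_sub] at h1
    have h2 := (abs_le.1 h1).2
    have h3 : φ (z - a) ≤ ‖φ‖ * ‖z - a‖ := (le_abs_self _).trans (φ.le_opNorm _)
    have h4 := descend a (by simpa using hδ0) s ⟨hs0.le, le_rfl⟩
    have h5 : (‖φ‖ + η) * ‖z - a‖ ≤ (‖φ‖ + η) * δ :=
      mul_le_mul_of_nonneg_left hz.le (by positivity)
    nlinarith
  have hKmem : ∀ z ∈ Metric.ball a r, ρ z ≤ 0 → z ∈ K := fun z hz h =>
    (hKW.superset ⟨(hball z hz z hz).1, h⟩).1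
  have vertical : ∀ z, ‖z - a‖ < δ → ρ z ≤ 0 → segment ℝ z (z + s • v) ⊆ K := by
    intro z hz hz0
    rw [segment_eq_image']
    rintro _ ⟨t, ht, rfl⟩
    have hts : t * s ∈ Icc (0 : ℝ) s :=
      ⟨mul_nonneg ht.1 hs0.le, mul_le_of_le_one_left hs0.le ht.2⟩
    have heq : z + t • (z + s • v - z) = z + (t * s) • v := by
      rw [add_sub_cancel_left, smul_smul]
    simp only [heq]
    refine hKmem _ (memball z hz _ hts) ?_
    have := descend z hz _ hts
    linarith [hts.1]
  have horizontal : ∀ z, ‖z - a‖ < δ → segment ℝ (a + s • v) (z + s • v) ⊆ K := by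
    intro z hz
    rw [segment_eq_image']
    rintro _ ⟨t, ht, rfl⟩
    have heq : a + s • v + t • (z + s • v - (a + s • v)) = (a + t • (z - a)) + s • v := by
      rw [add_sub_add_right_eq_sub]; abel
    have hn : ‖a + t • (z - a) - a‖ < δ := by
      rw [add_sub_cancel_left, norm_smul, Real.norm_of_nonneg ht.1]
      exact (mul_le_of_le_one_left (norm_nonneg _) ht.2).trans_lt hz
    simp only [heq]
    exact hKmem _ (memball _ hn s ⟨hs0.le, le_rfl⟩) (hnear _ hn)
  have hev : ∀ᶠ z in nhdsWithin a K, z ∈ Metric.ball a δ :=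
    mem_nhdsWithin_of_mem_nhds (Metric.ball_mem_nhds a hδ0)
  filter_upwards [hev, self_mem_nhdsWithin] with z hz hzK
  rw [mem_ball_iff_norm] at hz
  have hzW : z ∈ W := by
    have h0 := memball z hz 0 ⟨le_rfl, hs0.le⟩
    rw [zero_smul, add_zero] at h0
    exact (hball z h0 z h0).1
  have hz0 : ρ z ≤ 0 := (hKW.subset ⟨hzK, hzW⟩).2
  have p1 := isSmoothPathIn_of_segment_subset (vertical a (by simpa using hδ0) ha0)
  have p2 := isSmoothPathIn_of_segment_subset (horizontal z hz)
  have p3 := isSmoothPathIn_of_segment_subset (vertical z hz hz0)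
  exact ⟨_, (p1.trans p2).trans p3.symm⟩

lemma eventually_isSmoothPathIn_of_mem_interior (ha : a ∈ interior K) :
    ∀ᶠ z in nhdsWithin a K, ∃ c, IsSmoothPathIn K a z c := by
  obtain ⟨r, hr, hb⟩ := Metric.mem_nhds_iff.1 (mem_interior_iff_mem_nhds.1 ha)
  filter_upwards [mem_nhdsWithin_of_mem_nhds (Metric.ball_mem_nhds a hr)] with z hz
  exact ⟨_, isSmoothPathIn_of_segment_subset
    (((convex_ball a r).segment_subset (Metric.mem_ball_self hr) hz).trans hb)⟩

end Paths

lemma IsSmoothRegion.isCompact {M : ℕ} {K : Set (Fin M → ℝ)} (hK : IsSmoothRegion K) :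
    IsCompact K := by
  obtain ⟨Ω, _, hb, rfl⟩ := hK.closure_open
  exact hb.isCompact_closure

/-- Being joined by a smooth path is symmetric, transitive, and holds between a point and all nearby
points of `K`, so it holds throughout a preconnected subset. -/
lemma IsSmoothRegion.exists_isSmoothPathIn {M : ℕ} {K : Set (Fin M → ℝ)} (hK : IsSmoothRegion K)
    {a w : Fin M → ℝ} (ha : a ∈ K) (hw : w ∈ connectedComponentIn K a) :
    ∃ c, IsSmoothPathIn K a w c := by
  have hsub := connectedComponentIn_subset K a
  refine isPreconnected_connectedComponentIn.induction₂ (s := connectedComponentIn K a)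
    (fun x y => ∃ c, IsSmoothPathIn K x y c) ?_ ?_ ?_ (mem_connectedComponentIn ha) hw
  · intro x hx
    have hxK := hsub hx
    refine Filter.Eventually.filter_mono (nhdsWithin_mono x hsub) ?_
    by_cases hxi : x ∈ interior K
    · exact eventually_isSmoothPathIn_of_mem_interior hxi
    · obtain ⟨W, ρ, hW, hxW, hρ, hρx, hKW⟩ :=
        hK.smooth_boundary x ⟨subset_closure hxK, hxi⟩
      exact eventually_isSmoothPathIn_of_sublevel hW hxW hxK hρ hρx hKW
  · rintro x y z _ _ _ ⟨c, hc⟩ ⟨c', hc'⟩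
    exact ⟨_, hc.trans hc'⟩
  · rintro x y _ _ ⟨c, hc⟩
    exact ⟨_, hc.symm⟩

end Mayer

/-! ### Growth across the needle window, and the first variation. -/

namespace Mayer

set_option linter.unusedSectionVars false

/-- The total growth of a function whose derivative is bounded below by `-μ` outside of the window
`|t - τ| ≤ 2 ε`, by `-ν` for `ε ≤ |t - τ| ≤ 2 ε`, by `m` for `|t - τ| ≤ κ ε`, and by `-R`
throughout. -/
lemma le_sub_of_needle_bounds {T τ ε κ m μ ν R : ℝ} {g g' : ℝ → ℝ} (hε : 0 < ε) (hκ0 : 0 ≤ κ)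
    (hκ1 : κ < 1) (h6 : 2 * ε ≤ τ) (h7 : 2 * ε ≤ T - τ)
    (hgd : ∀ t ∈ Icc 0 T, HasDerivWithinAt g (g' t) (Icc 0 T) t) (hμ : 0 ≤ μ)
    (outer : ∀ t ∈ Icc 0 T, 2 * ε ≤ |t - τ| → -μ ≤ g' t)
    (ring_bound : ∀ t ∈ Icc 0 T, ε ≤ |t - τ| → |t - τ| ≤ 2 * ε → -ν ≤ g' t)
    (transition : ∀ t ∈ Icc 0 T, -R ≤ g' t)
    (inner : ∀ t ∈ Icc 0 T, |t - τ| ≤ κ * ε → m ≤ g' t) :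
    2 * m * κ * ε - 2 * R * (1 - κ) * ε - 2 * ν * ε - μ * T ≤ g T - g 0 := by
  have hκε : κ * ε ≤ ε := mul_le_of_le_one_left hε.le hκ1.le
  have hκε0 : 0 ≤ κ * ε := by positivity
  have i1 := mul_sub_le_sub_of_le_derivWithin (a := 0) (b := τ - 2 * ε) hgd le_rfl (by linarith)
    (by linarith) fun t ht => outer t ⟨by linarith [ht.1], by linarith [ht.2]⟩
      (by rw [abs_sub_comm]; exact le_trans (by linarith [ht.2]) (le_abs_self _))
  have i2 := mul_sub_le_sub_of_le_derivWithin (a := τ - 2 * ε) (b := τ - ε) hgd (by linarith)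
    (by linarith) (by linarith) fun t ht => ring_bound t ⟨by linarith [ht.1], by linarith [ht.2]⟩
      (by rw [abs_sub_comm]; exact le_trans (by linarith [ht.2]) (le_abs_self _))
      (abs_le.2 ⟨by linarith [ht.1], by linarith [ht.2]⟩)
  have i3 := mul_sub_le_sub_of_le_derivWithin (a := τ - ε) (b := τ - κ * ε) hgd (by linarith)
    (by linarith) (by linarith) fun t ht => transition t ⟨by linarith [ht.1], by linarith [ht.2]⟩
  have i4 := mul_sub_le_sub_of_le_derivWithin (a := τ - κ * ε) (b := τ + κ * ε) hgd (by linarith)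
    (by linarith) (by linarith) fun t ht => inner t ⟨by linarith [ht.1], by linarith [ht.2]⟩
      (abs_le.2 ⟨by linarith [ht.1], by linarith [ht.2]⟩)
  have i5 := mul_sub_le_sub_of_le_derivWithin (a := τ + κ * ε) (b := τ + ε) hgd (by linarith)
    (by linarith) (by linarith) fun t ht => transition t ⟨by linarith [ht.1], by linarith [ht.2]⟩
  have i6 := mul_sub_le_sub_of_le_derivWithin (a := τ + ε) (b := τ + 2 * ε) hgd (by linarith)
    (by linarith) (by linarith) fun t ht => ring_bound t ⟨by linarith [ht.1], by linarith [ht.2]⟩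
      (le_trans (by linarith [ht.1]) (le_abs_self _))
      (abs_le.2 ⟨by linarith [ht.1], by linarith [ht.2]⟩)
  have i7 := mul_sub_le_sub_of_le_derivWithin (a := τ + 2 * ε) (b := T) hgd (by linarith)
    (by linarith) le_rfl fun t ht => outer t ⟨by linarith [ht.1], by linarith [ht.2]⟩
      (le_trans (by linarith [ht.1]) (le_abs_self _))
  -- The outer intervals have total length `T - 4 ε`; the conclusion charges `μ` for all of `T`.
  have hμε : 0 ≤ μ * (4 * ε) := by positivity
  linarith

/-! ### The first variation along a needle variation

All objects are written in a frame that moves with a reference curve, which thus becomes the zero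
curve: `G t y v` is the velocity at displacement `y` under the control value `v`, and `A` its
differential with respect to `y`. -/

section Variation

variable {E V : Type*} [NormedAddCommGroup E] [NormedSpace ℝ E] [NormedAddCommGroup V]
  [NormedSpace ℝ V]

/-- The rate of change of `ℓ y` along a displacement `y` driven by the control value `v`, when `ℓ`
solves the adjoint equation along the reference control `u`. -/
noncomputable def pairingRate (G : ℝ → E → V → E) (A : ℝ → E → V → E →L[ℝ] E) (u : ℝ → V)
    (ℓ : ℝ → E →L[ℝ] ℝ) (t : ℝ) (y : E) (v : V) : ℝ :=
  ℓ t (G t y v - G t 0 (u t) - A t 0 (u t) y)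

variable {T : ℝ} {K : Set V} {G : ℝ → E → V → E} {A : ℝ → E → V → E →L[ℝ] E} {u : ℝ → V}
  {ℓ : ℝ → E →L[ℝ] ℝ}

lemma continuousOn_pairingRate
    (hG : ContinuousOn (fun z : ℝ × E × V => G z.1 z.2.1 z.2.2) (Icc 0 T ×ˢ (univ ×ˢ K)))
    (hAc : ContinuousOn (fun z : ℝ × E × V => A z.1 z.2.1 z.2.2) (Icc 0 T ×ˢ (univ ×ˢ K)))
    (hu : ContinuousOn u (Icc 0 T)) (huK : MapsTo u (Icc 0 T) K)
    (hℓ : ContinuousOn ℓ (Icc 0 T)) :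
    ContinuousOn (fun z : ℝ × E × V => pairingRate G A u ℓ z.1 z.2.1 z.2.2)
      (Icc 0 T ×ˢ (univ ×ˢ K)) := by
  have hfst : MapsTo (Prod.fst : ℝ × E × V → ℝ) (Icc 0 T ×ˢ (univ ×ˢ K)) (Icc 0 T) :=
    fun z hz => hz.1
  have hbase : ContinuousOn (fun z : ℝ × E × V => ((z.1, 0, u z.1) : ℝ × E × V))
      (Icc 0 T ×ˢ (univ ×ˢ K)) :=
    continuousOn_fst.prodMk (continuousOn_const.prodMk (hu.comp continuousOn_fst hfst))
  have hmaps : MapsTo (fun z : ℝ × E × V => ((z.1, 0, u z.1) : ℝ × E × V))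
      (Icc 0 T ×ˢ (univ ×ˢ K)) (Icc 0 T ×ˢ (univ ×ˢ K)) :=
    fun z hz => ⟨hz.1, mem_univ _, huK hz.1⟩
  exact (hℓ.comp continuousOn_fst hfst).clm_apply ((hG.sub (hG.comp hbase hmaps)).sub
    ((hAc.comp hbase hmaps).clm_apply continuousOn_snd.fst))

/-- Product rule: the adjoint equation contributes exactly minus the linear part of the motion of
`y`. -/
lemma hasDerivWithinAt_pairing {y : ℝ → E} {v : ℝ → V} {t : ℝ}
    (hℓ : HasDerivWithinAt ℓ (-(ℓ t).comp (A t 0 (u t))) (Icc 0 T) t)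
    (hy : HasDerivWithinAt y (G t (y t) (v t) - G t 0 (u t)) (Icc 0 T) t) :
    HasDerivWithinAt (fun s => ℓ s (y s)) (pairingRate G A u ℓ t (y t) (v t)) (Icc 0 T) t := by
  refine (hℓ.clm_apply hy).congr_deriv ?_
  simp only [pairingRate, map_sub, neg_apply, ContinuousLinearMap.comp_apply]
  ring

variable [ProperSpace E]

lemma isCompact_tube (hK : IsCompact K) :
    IsCompact (Icc (0 : ℝ) T ×ˢ (Metric.closedBall (0 : E) 1 ×ˢ K)) :=
  isCompact_Icc.prod ((isCompact_closedBall 0 1).prod hK)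

lemma exists_tube_bound {X : Type*} [NormedAddCommGroup X] (hK : IsCompact K)
    {H : ℝ → E → V → X}
    (hH : ContinuousOn (fun z : ℝ × E × V => H z.1 z.2.1 z.2.2) (Icc 0 T ×ˢ (univ ×ˢ K))) :
    ∃ B, 0 ≤ B ∧ ∀ t ∈ Icc 0 T, ∀ y : E, ‖y‖ ≤ 1 → ∀ v ∈ K, ‖H t y v‖ ≤ B := by
  obtain ⟨B, hB⟩ := (isCompact_tube (T := T) (E := E) hK).exists_bound_of_continuousOn
    (hH.mono (prod_mono_right (prod_mono_left (subset_univ _))))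
  refine ⟨max B 0, le_max_right _ _, fun t ht y hy v hv => ?_⟩
  exact (hB (t, y, v) ⟨ht, by simpa using hy, hv⟩).trans (le_max_left _ _)

/-- Along the reference control the pairing rate is of higher order in the displacement. -/
lemma exists_abs_pairingRate_le (hK : IsCompact K)
    (hA : ∀ t ∈ Icc 0 T, ∀ y, ∀ v ∈ K, HasFDerivAt (fun z => G t z v) (A t y v) y)
    (hAc : ContinuousOn (fun z : ℝ × E × V => A z.1 z.2.1 z.2.2) (Icc 0 T ×ˢ (univ ×ˢ K)))
    (huK : MapsTo u (Icc 0 T) K) (hℓ : ContinuousOn ℓ (Icc 0 T)) {ν : ℝ} (hν : 0 < ν) :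
    ∃ δ > 0, ∀ t ∈ Icc 0 T, ∀ y, ‖y‖ ≤ δ → |pairingRate G A u ℓ t y (u t)| ≤ ν * ‖y‖ := by
  obtain ⟨P, hP⟩ := isCompact_Icc.exists_bound_of_continuousOn hℓ
  have hP0 : 0 < |P| + 1 := by positivity
  have huc := (isCompact_tube (T := T) (E := E) hK).uniformContinuousOn_of_continuous
    (hAc.mono (prod_mono_right (prod_mono_left (subset_univ _))))
  obtain ⟨δ, hδ, h⟩ := Metric.uniformContinuousOn_iff.1 huc (ν / (|P| + 1)) (by positivity)
  refine ⟨min (δ / 2) 1, by positivity, fun t ht y hy => ?_⟩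
  have key : ‖G t y (u t) - G t 0 (u t) - A t 0 (u t) (y - 0)‖ ≤ ν / (|P| + 1) * ‖y - 0‖ := by
    refine (convex_closedBall (0 : E) (min (δ / 2) 1)).norm_image_sub_le_of_norm_hasFDerivWithin_le'
      (f := fun z => G t z (u t)) (f' := fun z => A t z (u t))
      (fun z _ => (hA t ht z _ (huK ht)).hasFDerivWithinAt) ?_
      (Metric.mem_closedBall_self (by positivity)) (by simpa using hy)
    intro z hz
    rw [mem_closedBall_zero_iff] at hz
    rw [← dist_eq_norm]
    refine (h (t, z, u t) ⟨ht, ?_, huK ht⟩ (t, 0, u t) ⟨ht, by simp, huK ht⟩ ?_).le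
    · simpa using hz.trans (min_le_right _ _)
    · have : ‖z‖ < δ := by have := hz.trans (min_le_left _ _); linarith
      simpa [Prod.dist_eq, hδ] using this
  rw [sub_zero] at key
  have hPt : ‖ℓ t‖ ≤ |P| + 1 := (hP t ht).trans ((le_abs_self P).trans (by linarith))
  calc |pairingRate G A u ℓ t y (u t)| ≤ ‖ℓ t‖ * ‖G t y (u t) - G t 0 (u t) - A t 0 (u t) y‖ :=
        (ℓ t).le_opNorm _
    _ ≤ (|P| + 1) * (ν / (|P| + 1) * ‖y‖) := by gcongr
    _ = ν * ‖y‖ := by field_simp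

lemma norm_sub_le_of_tube_bound {L : ℝ}
    (hA : ∀ t ∈ Icc 0 T, ∀ y, ∀ v ∈ K, HasFDerivAt (fun z => G t z v) (A t y v) y)
    (hL : ∀ t ∈ Icc 0 T, ∀ y : E, ‖y‖ ≤ 1 → ∀ v ∈ K, ‖A t y v‖ ≤ L) {t : ℝ} (ht : t ∈ Icc 0 T)
    {y : E} (hy : ‖y‖ ≤ 1) {v : V} (hv : v ∈ K) : ‖G t y v - G t 0 v‖ ≤ L * ‖y‖ := by
  have := (convex_closedBall (0 : E) 1).norm_image_sub_le_of_norm_hasFDerivWithin_le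
      (f := fun z => G t z v) (f' := fun z => A t z v)
      (fun z _ => (hA t ht z _ hv).hasFDerivWithinAt)
      (fun z hz => hL t ht z (by simpa using hz) v hv)
      (Metric.mem_closedBall_self (by positivity)) (show y ∈ _ by simpa using hy)
  simpa using this

lemma eventually_mul_le (a : ℝ) {r : ℝ} (hr : 0 < r) : ∀ᶠ ε in nhdsWithin (0 : ℝ) (Ioi 0), a * ε ≤ r := by
  have : Filter.Tendsto (fun ε : ℝ => a * ε) (nhdsWithin 0 (Ioi 0)) (nhds (a * 0)) :=
    ((continuous_const.mul continuous_id).tendsto 0).mono_left nhdsWithin_le_nhds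
  rw [mul_zero] at this
  exact this.eventually_le_const hr

/-- The maximum principle in a moving frame: if no smooth control lowers the cost `J`, then moving
along a smooth path of control values does not increase the Pontryagin function. -/
theorem le_of_needle_variations {J : E → ℝ} (hK : IsCompact K)
    (hG : ContinuousOn (fun z : ℝ × E × V => G z.1 z.2.1 z.2.2) (Icc 0 T ×ˢ (univ ×ˢ K)))
    (hA : ∀ t ∈ Icc 0 T, ∀ y, ∀ v ∈ K, HasFDerivAt (fun z => G t z v) (A t y v) y)
    (hAc : ContinuousOn (fun z : ℝ × E × V => A z.1 z.2.1 z.2.2) (Icc 0 T ×ˢ (univ ×ˢ K)))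
    (hu : ContDiffOn ℝ ∞ u (Icc 0 T)) (huK : MapsTo u (Icc 0 T) K)
    (hℓ : ∀ t ∈ Icc 0 T, HasDerivWithinAt ℓ (-(ℓ t).comp (A t 0 (u t))) (Icc 0 T) t)
    (hJ : HasFDerivAt J (-ℓ T) 0)
    (hmin : ∀ v, ContDiffOn ℝ ∞ v (Icc 0 T) → MapsTo v (Icc 0 T) K → ∃ y : ℝ → E, y 0 = 0 ∧
      (∀ t ∈ Icc 0 T, HasDerivWithinAt y (G t (y t) (v t) - G t 0 (u t)) (Icc 0 T) t) ∧
      J 0 ≤ J (y T))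
    {τ : ℝ} (hτ : τ ∈ Ioo 0 T) {w : V} {c : ℝ → V} (hc : IsSmoothPathIn K (u τ) w c) :
    ℓ τ (G τ 0 w) ≤ ℓ τ (G τ 0 (u τ)) := by
  by_contra! hlt
  have hwK : w ∈ K := hc.right 1 le_rfl ▸ hc.mem 1
  have hτ' : τ ∈ Icc 0 T := Ioo_subset_Icc_self hτ
  have hT : 0 ≤ T := hτ'.1.trans hτ'.2
  have hℓc : ContinuousOn ℓ (Icc 0 T) := fun t ht => (hℓ t ht).continuousWithinAt
  have hΦc := continuousOn_pairingRate hG hAc hu.continuousOn huK hℓc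
  set Φ := pairingRate G A u ℓ with hΦ
  set Δ : ℝ := ℓ τ (G τ 0 w) - ℓ τ (G τ 0 (u τ)) with hΔ
  have hΔ0 : 0 < Δ := sub_pos.2 hlt
  obtain ⟨L, hL0, hL⟩ := exists_tube_bound hK hAc
  obtain ⟨B, hB0, hB⟩ := exists_tube_bound hK hG
  obtain ⟨R, hR0, hR⟩ := exists_tube_bound hK hΦc
  set C₀ : ℝ := 4 * (5 * (2 * B) + 1) * Real.exp ((L + 1) * T) with hC₀
  have hC₀0 : 0 < C₀ := by positivity
  -- With `‖y‖ ≤ C₀ ε`, this constant limits the loss outside the window, over all of `[0, T]`, to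
  -- `Δ ε / 16`.
  obtain ⟨δ, hδ0, hδ⟩ := exists_abs_pairingRate_le (ν := Δ / (16 * (C₀ * T + 1))) hK hA hAc huK hℓc
    (by positivity)
  obtain ⟨δJ, hδJ0, hδJ⟩ : ∃ δ > 0, ∀ y, ‖y‖ ≤ δ →
      J y - J 0 + ℓ T y ≤ Δ / (16 * C₀) * ‖y‖ := by
    have := (hasFDerivAt_iff_isLittleO_nhds_zero.1 hJ).def (c := Δ / (16 * C₀)) (by positivity)
    obtain ⟨δ, hδ, h⟩ := Metric.nhds_basis_closedBall.eventually_iff.1 this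
    refine ⟨δ, hδ, fun y hy => ?_⟩
    have := (le_abs_self _).trans (h (x := y) (by simpa using hy))
    simpa using this
  obtain ⟨r₁, hr₁0, hr₁⟩ : ∃ r > 0, ∀ t ∈ Icc 0 T, |t - τ| < r → ∀ y, ‖y‖ < r →
      Δ / 2 ≤ Φ t y w := by
    have h1 : ContinuousWithinAt (fun z : ℝ × E => Φ z.1 z.2 w) (Icc 0 T ×ˢ univ) (τ, 0) :=
      (hΦc.comp (f := fun z : ℝ × E => (z.1, z.2, w)) (by fun_prop)
        (fun z hz => ⟨hz.1, mem_univ _, hwK⟩)) (τ, 0) ⟨hτ', mem_univ _⟩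
    obtain ⟨r, hr, h⟩ := Metric.continuousWithinAt_iff.1 h1 (Δ / 2) (by positivity)
    refine ⟨r, hr, fun t ht htr y hy => ?_⟩
    have h2 := h (x := (t, y)) ⟨ht, mem_univ _⟩
      (by rw [Prod.dist_eq]; exact max_lt (by simpa [Real.dist_eq] using htr) (by simpa using hy))
    have h3 : Φ τ 0 w = Δ := by simp [hΦ, pairingRate, hΔ]
    rw [Real.dist_eq] at h2
    have := (abs_lt.1 h2).1
    simp only [h3] at this
    linarith
  -- For `ε ≤ |t - τ| ≤ 2 ε` the control is `u` at the stopped time, hence the separate time `s`.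
  -- The rate vanishes at `(τ, 0, u τ)`.
  obtain ⟨r₂, hr₂0, hr₂⟩ : ∃ r > 0, ∀ t ∈ Icc 0 T, |t - τ| < r → ∀ y, ‖y‖ < r →
      ∀ s ∈ Icc 0 T, |s - τ| < r → -(Δ / 32) ≤ Φ t y (u s) := by
    have h1 : ContinuousWithinAt (fun z : ℝ × E × ℝ => Φ z.1 z.2.1 (u z.2.2))
        (Icc 0 T ×ˢ (univ ×ˢ Icc 0 T)) (τ, 0, τ) :=
      (hΦc.comp (f := fun z : ℝ × E × ℝ => (z.1, z.2.1, u z.2.2))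
        (continuousOn_fst.prodMk (continuousOn_snd.fst.prodMk
          (hu.continuousOn.comp continuousOn_snd.snd fun z hz => hz.2.2)))
        (fun z hz => ⟨hz.1, mem_univ _, huK hz.2.2⟩)) (τ, 0, τ) ⟨hτ', mem_univ _, hτ'⟩
    obtain ⟨r, hr, h⟩ := Metric.continuousWithinAt_iff.1 h1 (Δ / 32) (by positivity)
    refine ⟨r, hr, fun t ht htr y hy s hs hsr => ?_⟩
    have h2 := h (x := (t, y, s)) ⟨ht, mem_univ _, hs⟩
      (by
        rw [Prod.dist_eq, Prod.dist_eq]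
        exact max_lt (by simpa [Real.dist_eq] using htr)
          (max_lt (by simpa using hy) (by simpa [Real.dist_eq] using hsr)))
    have h3 : Φ τ 0 (u τ) = 0 := by simp [hΦ, pairingRate]
    rw [Real.dist_eq] at h2
    have := (abs_lt.1 h2).1
    simp only [h3] at this
    linarith
  obtain ⟨κ, hκ0, hκ1, hκR⟩ : ∃ κ : ℝ, 1 / 2 ≤ κ ∧ κ < 1 ∧ 2 * R * (1 - κ) ≤ Δ / 8 := by
    refine ⟨1 - min (1 / 2) (Δ / (16 * (R + 1))), ?_, ?_, ?_⟩
    · linarith [min_le_left (1 / 2) (Δ / (16 * (R + 1)))]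
    · have : 0 < min (1 / 2) (Δ / (16 * (R + 1))) := by positivity
      linarith
    · have h1 : min (1 / 2) (Δ / (16 * (R + 1))) ≤ Δ / (16 * (R + 1)) := min_le_right _ _
      have h2 : 0 ≤ min (1 / 2) (Δ / (16 * (R + 1))) := by positivity
      rw [le_div_iff₀ (by positivity)] at h1
      nlinarith
  -- The factor `C₀ + 2` controls both `‖y t‖ ≤ C₀ ε` and `|t - τ| ≤ 2 ε`.
  obtain ⟨ε, hε0, h1, h2, h3, h4, h5, h6, h7⟩ : ∃ ε : ℝ, 0 < ε ∧ C₀ * ε ≤ 1 ∧ C₀ * ε ≤ δ ∧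
      C₀ * ε ≤ δJ ∧ (C₀ + 2) * ε ≤ r₁ / 2 ∧ (C₀ + 2) * ε ≤ r₂ / 2 ∧ 2 * ε ≤ τ ∧
      2 * ε ≤ T - τ := by
    have hpos : ∀ᶠ ε in nhdsWithin (0 : ℝ) (Ioi 0), 0 < ε := eventually_mem_nhdsWithin
    exact (hpos.and <| (eventually_mul_le C₀ one_pos).and <| (eventually_mul_le C₀ hδ0).and <|
      (eventually_mul_le C₀ hδJ0).and <| (eventually_mul_le (C₀ + 2) (half_pos hr₁0)).and <|
      (eventually_mul_le (C₀ + 2) (half_pos hr₂0)).and <| (eventually_mul_le 2 hτ.1).and <|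
      eventually_mul_le 2 (sub_pos.2 hτ.2)).exists
  have hκsq : κ ^ 2 < 1 := by nlinarith
  set v := needleControl u c τ ε κ with hv
  have hvK : MapsTo v (Icc 0 T) K :=
    fun t ht => needleControl_mem (convex_Icc 0 T) hτ' huK hc hε0 hκsq ht
  obtain ⟨y, hy0, hy, hyJ⟩ := hmin v
    (contDiffOn_needleControl (convex_Icc 0 T) hτ' hu hc.contDiff) hvK
  have hyC : ∀ t ∈ Icc 0 T, ‖y t‖ ≤ C₀ * ε := by
    refine norm_le_of_window (B := 2 * B) (τ := τ) hε0 hL0 (by positivity) hy0 hy ?_ ?_ h1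
    · intro t ht hyt _
      have e1 := hB t ht (y t) hyt _ (hvK ht)
      have e2 := hB t ht 0 (by simp) _ (huK ht)
      exact (norm_sub_le _ _).trans (by linarith)
    · intro t ht hyt hfar
      rw [hv, needleControl_of_far hc hε0 hκsq hfar]
      exact norm_sub_le_of_tube_bound hA hL ht hyt (huK ht)
  set g : ℝ → ℝ := fun s => ℓ s (y s) with hg
  have hgd : ∀ t ∈ Icc 0 T, HasDerivWithinAt g (Φ t (y t) (v t)) (Icc 0 T) t :=
    fun t ht => hasDerivWithinAt_pairing (hℓ t ht) (hy t ht)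
  have hC₀ε : 0 < C₀ * ε := by positivity
  have outer : ∀ t ∈ Icc 0 T, 2 * ε ≤ |t - τ| →
      -(Δ / (16 * (C₀ * T + 1)) * (C₀ * ε)) ≤ Φ t (y t) (v t) := by
    intro t ht hfar
    rw [hv, needleControl_of_far hc hε0 hκsq hfar]
    have e1 := (abs_le.1 (hδ t ht (y t) ((hyC t ht).trans h2))).1
    have e2 : Δ / (16 * (C₀ * T + 1)) * ‖y t‖ ≤ Δ / (16 * (C₀ * T + 1)) * (C₀ * ε) :=
      mul_le_mul_of_nonneg_left (hyC t ht) (by positivity)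
    linarith
  have ring_bound : ∀ t ∈ Icc 0 T, ε ≤ |t - τ| → |t - τ| ≤ 2 * ε →
      -(Δ / 32) ≤ Φ t (y t) (v t) := by
    intro t ht hge hle
    rw [hv, needleControl_of_ge hc hε0 hκsq hge]
    have e1 := abs_stoppedTime_sub_le τ ε t
    have e2 := hyC t ht
    exact hr₂ t ht (by linarith) _ (by linarith) _
      (stoppedTime_mem (convex_Icc 0 T) hτ' ht ε) (by linarith)
  have transition : ∀ t ∈ Icc 0 T, -R ≤ Φ t (y t) (v t) := fun t ht =>
    (abs_le.1 (hR t ht (y t) ((hyC t ht).trans h1) _ (hvK ht))).1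
  have inner : ∀ t ∈ Icc 0 T, |t - τ| ≤ κ * ε → Δ / 2 ≤ Φ t (y t) (v t) := by
    intro t ht hle
    rw [hv, needleControl_of_near hc hε0 (by linarith) hκ1 hle]
    have e2 := hyC t ht
    have e3 : κ * ε ≤ ε := mul_le_of_le_one_left hε0.le hκ1.le
    exact hr₁ t ht (by linarith) _ (by linarith)
  have growth := le_sub_of_needle_bounds hε0 (by linarith) hκ1 h6 h7 hgd (by positivity)
    outer ring_bound transition inner
  have hg0 : g 0 = 0 := by simp [hg, hy0]
  have hout : Δ / (16 * (C₀ * T + 1)) * (C₀ * ε) * T ≤ Δ / 16 * ε := by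
    have : Δ / (16 * (C₀ * T + 1)) * (C₀ * ε) * T = Δ / 16 * ε * (C₀ * T / (C₀ * T + 1)) := by
      field_simp
    rw [this]
    exact mul_le_of_le_one_right (by positivity) ((div_le_one (by positivity)).2 (by linarith))
  have hcost : J (y T) - J 0 + g T ≤ Δ / 16 * ε := by
    have e1 := hyC T ⟨hT, le_rfl⟩
    refine (hδJ (y T) (e1.trans h3)).trans ?_
    calc Δ / (16 * C₀) * ‖y T‖ ≤ Δ / (16 * C₀) * (C₀ * ε) := by gcongr
      _ = Δ / 16 * ε := by field_simp
  have hR2 : 2 * R * (1 - κ) * ε ≤ Δ / 8 * ε := mul_le_mul_of_nonneg_right hκR hε0.le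
  have hin : Δ / 2 * ε ≤ Δ * κ * ε := by
    have : Δ / 2 ≤ Δ * κ := by nlinarith
    exact mul_le_mul_of_nonneg_right this hε0.le
  have hΔε : 0 < Δ * ε := by positivity
  -- In units of `Δ ε`: the gain is at least `1/2`, and the losses are `1/8` (transitions), `1/16`
  -- (ring), `1/16` (outside) and `1/16` (nonlinearity of `J`). Hence `J (y T) < J 0`.
  rw [hg0, sub_zero] at growth
  linarith

end Variation

end Mayer

namespace Mayer

/-! ### The Euler-Lagrange equations of the classical Lagrangian -/

section EulerLagrange

variable {N M : ℕ} {T : ℝ} {K : Set (Fin M → ℝ)} {x₀ : Fin N → ℝ}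
  {f : ℝ → (Fin N → ℝ) → (Fin M → ℝ) → (Fin N → ℝ)} {C : (Fin N → ℝ) → ℝ}

lemma eulerLagrange_one {n : ℕ} {ι V : Type} [Fintype ι] [DecidableEq ι]
    (L : ℝ → Jet (n + 1) ι → V → ℝ) (i : ι) (t : ℝ) (j : Jet (n + 1) ι) (v : V) :
    eulerLagrange 1 L i t j v = jetPartial L 0 i t j v - totalDeriv (jetPartial L 1 i) t j v := by
  have h : Finset.univ.filter (fun β : Fin (n + 2) => 1 ≤ β.val ∧ β.val ≤ 1) = {1} := by
    ext β
    simp only [Finset.mem_filter, Finset.mem_univ, true_and, Finset.mem_singleton, Fin.ext_iff,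
      Fin.val_one]
    omega
  simp [eulerLagrange, h, sub_eq_add_neg]

/-- The Lagrangian is affine along velocity and costate coordinates, so these partial derivatives
are read off exact increments; only the state coordinates need differentiability of `f`. -/
lemma jetPartial_one_inr (i : Fin N) :
    jetPartial (classicalTriple T K x₀ f C).lagrangian 1 (Sum.inr i) = fun _ _ _ => 0 := by
  funext t j v
  refine HasLineDerivAt.lineDeriv ?_
  have h : ∀ s : ℝ, (classicalTriple T K x₀ f C).lagrangian t
      (j + s • (Pi.single 1 (Pi.single (Sum.inr i) 1) :
        Jet 3 (Fin N ⊕ Fin N))) v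
      = (classicalTriple T K x₀ f C).lagrangian t j v := fun s => by
    simp [classicalTriple, statePart, costatePart]
  unfold HasLineDerivAt
  simp only [h]
  exact hasDerivAt_const _ _

lemma jetPartial_one_inl (i : Fin N) :
    jetPartial (classicalTriple T K x₀ f C).lagrangian 1 (Sum.inl i)
      = fun _ j _ => j 0 (Sum.inr i) := by
  funext t j v
  refine HasLineDerivAt.lineDeriv ?_
  have h : ∀ s : ℝ, (classicalTriple T K x₀ f C).lagrangian t
      (j + s • (Pi.single 1 (Pi.single (Sum.inl i) 1) :
        Jet 3 (Fin N ⊕ Fin N))) v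
      = (classicalTriple T K x₀ f C).lagrangian t j v + s * j 0 (Sum.inr i) := fun s => by
    simp only [classicalTriple, statePart, costatePart]
    simp [Pi.single_apply, mul_sub, mul_add, Finset.sum_add_distrib, Finset.sum_sub_distrib]
    ring
  unfold HasLineDerivAt
  simp only [h]
  simpa using ((hasDerivAt_id (0 : ℝ)).mul_const (j 0 (Sum.inr i))).const_add
    ((classicalTriple T K x₀ f C).lagrangian t j v)

lemma jetPartial_zero_inr (i : Fin N) (t : ℝ) (j : Jet 3 (Fin N ⊕ Fin N)) (v : Fin M → ℝ) :
    jetPartial (classicalTriple T K x₀ f C).lagrangian 0 (Sum.inr i) t j v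
      = j 1 (Sum.inl i) - f t (statePart (j 0)) v i := by
  refine HasLineDerivAt.lineDeriv ?_
  have h : ∀ s : ℝ, (classicalTriple T K x₀ f C).lagrangian t
      (j + s • (Pi.single 0 (Pi.single (Sum.inr i) 1) :
        Jet 3 (Fin N ⊕ Fin N))) v
      = (classicalTriple T K x₀ f C).lagrangian t j v
        + s * (j 1 (Sum.inl i) - f t (statePart (j 0)) v i) := fun s => by
    have h0 : statePart ((j + s • (Pi.single 0 (Pi.single (Sum.inr i) 1) :
        Jet 3 (Fin N ⊕ Fin N))) 0) = statePart (j 0) := by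
      funext l; simp [statePart]
    simp only [classicalTriple, h0]
    simp [statePart, costatePart, Pi.single_apply, add_mul, Finset.sum_add_distrib]
  unfold HasLineDerivAt
  simp only [h]
  simpa using ((hasDerivAt_id (0 : ℝ)).mul_const
    (j 1 (Sum.inl i) - f t (statePart (j 0)) v i)).const_add
    ((classicalTriple T K x₀ f C).lagrangian t j v)

lemma jetPartial_zero_inl (i : Fin N) (t : ℝ) (j : Jet 3 (Fin N ⊕ Fin N)) (v : Fin M → ℝ)
    {D : (Fin N → ℝ) →L[ℝ] (Fin N → ℝ)}
    (hD : HasFDerivAt (fun x => f t x v) D (statePart (j 0))) :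
    jetPartial (classicalTriple T K x₀ f C).lagrangian 0 (Sum.inl i) t j v
      = -∑ l, costatePart (j 0) l * D (Pi.single i 1) l := by
  refine HasLineDerivAt.lineDeriv ?_
  have h : ∀ s : ℝ, (classicalTriple T K x₀ f C).lagrangian t
      (j + s • (Pi.single 0 (Pi.single (Sum.inl i) 1) :
        Jet 3 (Fin N ⊕ Fin N))) v
      = ∑ l, costatePart (j 0) l * (statePart (j 1) l
        - f t (statePart (j 0) + s • Pi.single i 1) v l) := fun s => by
    have h0 : statePart ((j + s • (Pi.single 0 (Pi.single (Sum.inl i) 1) :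
        Jet 3 (Fin N ⊕ Fin N))) 0) = statePart (j 0) + s • Pi.single i 1 := by
      funext l; simp [statePart, Pi.single_apply]
    simp only [classicalTriple, h0]
    simp [statePart, costatePart]
  unfold HasLineDerivAt
  simp only [h]
  have h1 := hasDerivAt_pi.1 (hD.hasLineDerivAt (Pi.single i 1))
  have h2 := HasDerivAt.fun_sum (u := Finset.univ) fun l _ =>
    ((h1 l).const_sub (statePart (j 1) l)).const_mul (costatePart (j 0) l)
  simpa using h2

lemma totalDeriv_const_zero {n : ℕ} {ι V : Type} [Fintype ι] [DecidableEq ι]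
    (t : ℝ) (j : Jet n ι) (v : V) : totalDeriv (fun _ _ _ => (0 : ℝ)) t j v = 0 := by
  simp [totalDeriv, jetPartial, lineDeriv]

lemma totalDeriv_coord {n : ℕ} {ι V : Type} [Fintype ι] [DecidableEq ι] (a : ι)
    (t : ℝ) (j : Jet (n + 1) ι) (v : V) :
    totalDeriv (fun _ (j : Jet (n + 1) ι) (_ : V) => j 0 a) t j v = j 1 a := by
  have h : ∀ (δ : Fin (n + 1)) (l : ι), jetPartial (fun _ (j : Jet (n + 1) ι) (_ : V) => j 0 a)
      δ.castSucc l t j v = if δ = 0 ∧ l = a then 1 else 0 := by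
    intro δ l
    refine HasLineDerivAt.lineDeriv ?_
    have h1 : ∀ s : ℝ, (j + s • (Pi.single δ.castSucc (Pi.single l 1) : Jet (n + 1) ι)) 0 a
        = j 0 a + s * (if δ = 0 ∧ l = a then 1 else 0) := fun s => by
      by_cases hδ : δ = 0
      · subst hδ
        by_cases hl : l = a
        · subst hl; simp
        · simp [hl, Ne.symm hl]
      · have : (0 : Fin (n + 2)) ≠ δ.castSucc := by
          intro h
          exact hδ (Fin.castSucc_eq_zero_iff.1 h.symm)
        rw [Pi.add_apply, Pi.smul_apply, Pi.single_eq_of_ne this]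
        simp [hδ]
    unfold HasLineDerivAt
    simp only [h1]
    have h2 := ((hasDerivAt_id (0 : ℝ)).mul_const
      (if δ = 0 ∧ l = a then (1 : ℝ) else 0)).const_add (j 0 a)
    rwa [one_mul] at h2
  simp only [totalDeriv, h, deriv_const, zero_add]
  rw [Finset.sum_eq_single 0, Finset.sum_eq_single a]
  · simp
  · intro l _ hl; simp [hl]
  · simp
  · intro δ _ hδ; simp [hδ]
  · simp

/-! ### State and adjoint equations of controlled curves. -/

variable {u : ℝ → (Fin M → ℝ)} {σ : Jet 0 (Fin N ⊕ Fin N)} {γ : ℝ → (Fin N ⊕ Fin N) → ℝ}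

lemma IsControlledCurve.apply_zero
    (h : IsControlledCurve T 1 (classicalTriple T K x₀ f C) (u, σ) γ) : γ 0 = σ 0 := by
  have := congrFun h.initial 0
  simpa [jetLift] using this

lemma IsControlledCurve.hasDerivWithinAt (h : IsControlledCurve T 1 (classicalTriple T K x₀ f C) (u, σ) γ) {t : ℝ}
    (ht : t ∈ Icc 0 T) : HasDerivWithinAt γ (jetLift T 3 γ t 1) (Icc 0 T) t := by
  have h1 := (h.contDiffOn.differentiableOn (by simp) t ht).hasDerivWithinAt
  have h2 : jetLift T 3 γ t 1 = derivWithin γ (Icc 0 T) t := by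
    simp [jetLift, iteratedDerivWithin_one]
  rwa [h2]

lemma jetLift_zero {ι : Type} [Fintype ι] (n : ℕ) (γ : ℝ → ι → ℝ) (t : ℝ) :
    jetLift T n γ t 0 = γ t := by
  simp [jetLift]

lemma IsControlledCurve.hasDerivWithinAt_state (h : IsControlledCurve T 1 (classicalTriple T K x₀ f C) (u, σ) γ) {t : ℝ}
    (ht : t ∈ Icc 0 T) :
    HasDerivWithinAt (fun s => statePart (γ s)) (f t (statePart (γ t)) (u t)) (Icc 0 T) t := by
  rw [hasDerivWithinAt_pi]
  intro i
  have h1 := hasDerivWithinAt_pi.1 (h.hasDerivWithinAt ht) (Sum.inl i)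
  have h2 := h.equations t ht (Sum.inr i)
  rw [eulerLagrange_one, jetPartial_one_inr, totalDeriv_const_zero, jetPartial_zero_inr,
    jetLift_zero, sub_zero, sub_eq_zero] at h2
  rw [h2] at h1
  exact h1

lemma IsControlledCurve.hasDerivWithinAt_costate (h : IsControlledCurve T 1 (classicalTriple T K x₀ f C) (u, σ) γ) {t : ℝ}
    (ht : t ∈ Icc 0 T) {D : (Fin N → ℝ) →L[ℝ] (Fin N → ℝ)}
    (hD : HasFDerivAt (fun x => f t x (u t)) D (statePart (γ t))) (i : Fin N) :
    HasDerivWithinAt (fun s => costatePart (γ s) i)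
      (-∑ l, costatePart (γ t) l * D (Pi.single i 1) l) (Icc 0 T) t := by
  have h1 := hasDerivWithinAt_pi.1 (h.hasDerivWithinAt ht) (Sum.inr i)
  have h2 := h.equations t ht (Sum.inl i)
  rw [eulerLagrange_one, jetPartial_one_inl, totalDeriv_coord, jetPartial_zero_inl (D := D),
    jetLift_zero, sub_eq_zero] at h2
  · rw [← h2] at h1
    exact h1
  · rwa [jetLift_zero]

end EulerLagrange

end Mayer

namespace Mayer

/-! ### Differentiability in the state variable -/

/-- Derivatives within the domain need not be unique, but the domain is full in the `x` direction.
There any of them restricts to the true derivative of the slice, which thus inherits continuity from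
a local continuous choice. -/
lemma exists_fderiv_slice {E V F : Type*} [NormedAddCommGroup E] [NormedSpace ℝ E]
    [NormedAddCommGroup V] [NormedSpace ℝ V] [NormedAddCommGroup F] [NormedSpace ℝ F]
    {I : Set ℝ} {K : Set V} {f : ℝ → E → V → F}
    (hf : ContDiffOn ℝ ∞ (fun z : ℝ × E × V => f z.1 z.2.1 z.2.2) (I ×ˢ (univ ×ˢ K))) :
    ∃ D : ℝ → E → V → E →L[ℝ] F,
      (∀ t ∈ I, ∀ x, ∀ v ∈ K, HasFDerivAt (fun y => f t y v) (D t x v) x) ∧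
      ContinuousOn (fun z : ℝ × E × V => D z.1 z.2.1 z.2.2) (I ×ˢ (univ ×ˢ K)) := by
  set S : Set (ℝ × E × V) := I ×ˢ (univ ×ˢ K) with hS
  set inj : E →L[ℝ] ℝ × E × V :=
    (0 : E →L[ℝ] ℝ).prod ((ContinuousLinearMap.id ℝ E).prod (0 : E →L[ℝ] V))
  have key : ∀ z₀ ∈ S, ∃ f' : ℝ × E × V → (ℝ × E × V →L[ℝ] F), ContinuousWithinAt f' S z₀ ∧
      ∀ᶠ z in nhdsWithin z₀ S,
        HasFDerivAt (fun y => f z.1 y z.2.2) ((f' z).comp inj) z.2.1 := by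
    intro z₀ hz₀
    have h1 : ContDiffWithinAt ℝ (0 + 1) (fun z : ℝ × E × V => f z.1 z.2.1 z.2.2) S z₀ :=
      (hf z₀ hz₀).of_le (by simp)
    obtain ⟨U, hU, hUS, -, f', hf', hc⟩ :=
      (contDiffWithinAt_succ_iff_hasFDerivWithinAt' (by simp)).1 h1
    rw [insert_eq_of_mem hz₀] at hU hUS
    refine ⟨f', hc.continuousWithinAt, Filter.mem_of_superset hU fun z hz => ?_⟩
    have h2 : HasFDerivAt (fun y : E => ((z.1, y, z.2.2) : ℝ × E × V)) inj z.2.1 :=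
      (hasFDerivAt_const z.1 z.2.1).prodMk ((hasFDerivAt_id z.2.1).prodMk
        (hasFDerivAt_const z.2.2 z.2.1))
    have h3 := HasFDerivWithinAt.comp (t := S) (s := univ) z.2.1 (hf' z hz) h2.hasFDerivWithinAt
      fun y _ => ⟨(hUS hz).1, mem_univ _, (hUS hz).2.2⟩
    exact hasFDerivWithinAt_univ.1 h3
  refine ⟨fun t x v => fderiv ℝ (fun y => f t y v) x, fun t ht x v hv => ?_, fun z₀ hz₀ => ?_⟩
  · obtain ⟨f', -, h⟩ := key (t, x, v) ⟨ht, mem_univ _, hv⟩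
    exact (h.self_of_nhdsWithin ⟨ht, mem_univ _, hv⟩).differentiableAt.hasFDerivAt
  · obtain ⟨f', hc, h⟩ := key z₀ hz₀
    have h1 : ContinuousWithinAt (fun z => (f' z).comp inj) S z₀ :=
      hc.clm_comp continuousWithinAt_const
    exact h1.congr_of_eventuallyEq (h.mono fun z hz => hz.fderiv)
      (h.self_of_nhdsWithin hz₀).fderiv

/-! ### The maximum principle -/

/-- The covector with coordinates `p`. -/
noncomputable def covector {N : ℕ} (p : Fin N → ℝ) : (Fin N → ℝ) →L[ℝ] ℝ :=
  ∑ i, p i • ContinuousLinearMap.proj i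

lemma covector_apply {N : ℕ} (p y : Fin N → ℝ) : covector p y = ∑ i, p i * y i := by
  simp [covector]

lemma clm_ext_single {N : ℕ} {a b : (Fin N → ℝ) →L[ℝ] ℝ}
    (h : ∀ i, a (Pi.single i 1) = b (Pi.single i 1)) : a = b :=
  ContinuousLinearMap.coe_injective (LinearMap.pi_ext' fun i => LinearMap.ext_ring (h i))

lemma covector_single {N : ℕ} (p : Fin N → ℝ) (i : Fin N) :
    covector p (Pi.single i 1) = p i := by
  simp [covector_apply, Pi.single_apply]

lemma pontryagin_eq_covector {N M : ℕ} (f : ℝ → (Fin N → ℝ) → (Fin M → ℝ) → (Fin N → ℝ))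
    (t : ℝ) (x p : Fin N → ℝ) (w : Fin M → ℝ) : pontryagin f t x p w = covector p (f t x w) := by
  rw [pontryagin, covector_apply]

lemma hasDerivWithinAt_covector {N : ℕ} {s : Set ℝ} {t : ℝ} {p : ℝ → Fin N → ℝ}
    {D : (Fin N → ℝ) →L[ℝ] (Fin N → ℝ)}
    (hp : ∀ i, HasDerivWithinAt (fun r => p r i) (-∑ l, p t l * D (Pi.single i 1) l) s t) :
    HasDerivWithinAt (fun r => covector (p r)) (-(covector (p t)).comp D) s t := by
  have h := HasDerivWithinAt.fun_sum (u := Finset.univ) fun i _ =>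
    (hp i).smul_const (ContinuousLinearMap.proj (R := ℝ) (φ := fun _ : Fin N => ℝ) i)
  refine h.congr_deriv (clm_ext_single fun i => ?_)
  have h2 : ∀ q : Fin N → ℝ, (∑ l, q l •
      ContinuousLinearMap.proj (R := ℝ) (φ := fun _ : Fin N => ℝ) l) = covector q := fun _ => rfl
  rw [h2 (fun i => -∑ l, p t l * D (Pi.single i 1) l), covector_single, neg_apply,
    ContinuousLinearMap.comp_apply, covector_apply]

end Mayer

/-! ### The maximum principle, by passing to the frame moving with the optimal state. -/

theorem corollary7p6 {N M : ℕ} (T : ℝ) (hT : 0 < T)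
    (K : Set (Fin M → ℝ)) (hK : Mayer.IsSmoothRegion K)
    (x₀ : Fin N → ℝ)
    (f : ℝ → (Fin N → ℝ) → (Fin M → ℝ) → (Fin N → ℝ))
    (hf : ContDiffOn ℝ ∞ (fun z : ℝ × (Fin N → ℝ) × (Fin M → ℝ) => f z.1 z.2.1 z.2.2)
      (Icc 0 T ×ˢ (univ ×ˢ K)))
    (C : (Fin N → ℝ) → ℝ) (hC : ContDiff ℝ ∞ C)
    (hwp : Mayer.WellPosed T 1 (Mayer.classicalTriple T K x₀ f C))
    (u : ℝ → (Fin M → ℝ)) (σ : Mayer.Jet 0 (Fin N ⊕ Fin N))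
    (γ : ℝ → (Fin N ⊕ Fin N) → ℝ)
    (hopt : Mayer.IsSolution T 1 (Mayer.classicalTriple T K x₀ f C) (u, σ) γ)
    (hp : ∀ i : Fin N, Mayer.costatePart (γ T) i
      = - lineDeriv ℝ C (Mayer.statePart (γ T)) (Pi.single i 1)) :
    ∀ τ ∈ Ioc 0 T, ∀ w ∈ connectedComponentIn K (u τ),
      Mayer.pontryagin f τ (Mayer.statePart (γ τ)) (Mayer.costatePart (γ τ)) w
        ≤ Mayer.pontryagin f τ (Mayer.statePart (γ τ)) (Mayer.costatePart (γ τ)) (u τ) := by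
  intro τ hτ w hw
  obtain ⟨⟨⟨hu, huK, hσ⟩, hγ⟩, hmin⟩ := hopt
  obtain ⟨D, hD, hDc⟩ := Mayer.exists_fderiv_slice hf
  have hwK : w ∈ K := connectedComponentIn_subset _ _ hw
  have hτ' : τ ∈ Icc 0 T := Ioc_subset_Icc_self hτ
  set x : ℝ → Fin N → ℝ := fun t => Mayer.statePart (γ t) with hx
  set ℓ : ℝ → (Fin N → ℝ) →L[ℝ] ℝ := fun t => Mayer.covector (Mayer.costatePart (γ t)) with hℓ
  have hxd : ∀ t ∈ Icc 0 T, HasDerivWithinAt x (f t (x t) (u t)) (Icc 0 T) t :=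
    fun t ht => hγ.hasDerivWithinAt_state ht
  have hxc : ContinuousOn x (Icc 0 T) := fun t ht => (hxd t ht).continuousWithinAt
  have hℓd : ∀ t ∈ Icc 0 T, HasDerivWithinAt ℓ (-(ℓ t).comp (D t (x t) (u t))) (Icc 0 T) t :=
    fun t ht => Mayer.hasDerivWithinAt_covector
      fun i => hγ.hasDerivWithinAt_costate ht (hD t ht _ _ (huK ht)) i
  have hℓc : ContinuousOn ℓ (Icc 0 T) := fun t ht => (hℓd t ht).continuousWithinAt
  have hframe : ContinuousOn
      (fun z : ℝ × (Fin N → ℝ) × (Fin M → ℝ) => (z.1, x z.1 + z.2.1, z.2.2))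
      (Icc 0 T ×ˢ (univ ×ˢ K)) :=
    continuousOn_fst.prodMk (((hxc.comp continuousOn_fst fun z hz => hz.1).add
      continuousOn_snd.fst).prodMk continuousOn_snd.snd)
  have hframe_maps : MapsTo
      (fun z : ℝ × (Fin N → ℝ) × (Fin M → ℝ) => (z.1, x z.1 + z.2.1, z.2.2))
      (Icc 0 T ×ˢ (univ ×ˢ K)) (Icc 0 T ×ˢ (univ ×ˢ K)) := fun z hz => ⟨hz.1, mem_univ _, hz.2.2⟩
  have hJ : HasFDerivAt (fun y => C (x T + y)) (-ℓ T) 0 := by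
    have h1 := (hC.differentiable (by simp)).differentiableAt.hasFDerivAt (x := x T + 0)
    have h2 : fderiv ℝ C (x T + 0) = -ℓ T := by
      refine Mayer.clm_ext_single fun i => ?_
      rw [neg_apply, Mayer.covector_single, hp i, neg_neg, add_zero]
      exact ((hC.differentiable (by simp)).differentiableAt.lineDeriv_eq_fderiv).symm
    rw [h2] at h1
    have h3 := h1.comp 0 ((hasFDerivAt_id (𝕜 := ℝ) (0 : Fin N → ℝ)).const_add (x T))
    rwa [ContinuousLinearMap.comp_id] at h3
  have hvar : ∀ v, ContDiffOn ℝ ∞ v (Icc 0 T) → MapsTo v (Icc 0 T) K →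
      ∃ y : ℝ → Fin N → ℝ, y 0 = 0 ∧ (∀ t ∈ Icc 0 T,
        HasDerivWithinAt y (f t (x t + y t) (v t) - f t (x t + 0) (u t)) (Icc 0 T) t) ∧
        C (x T + 0) ≤ C (x T + y T) := by
    intro v hv hvK
    -- Keeping the same `σ` loses nothing: the state equation does not involve the costate.
    have hmem : (v, σ) ∈ (Mayer.classicalTriple T K x₀ f C).controls := ⟨hv, hvK, hσ⟩
    obtain ⟨γ', hγ', -⟩ := hwp _ hmem
    refine ⟨fun t => Mayer.statePart (γ' t) - x t, ?_, fun t ht => ?_, ?_⟩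
    · simp only [hx, hγ.apply_zero, hγ'.apply_zero, sub_self]
    · simp only [add_sub_cancel, add_zero]
      exact (hγ'.hasDerivWithinAt_state ht).sub (hxd t ht)
    · have h := hmin _ hmem γ' hγ'
      simp only [Mayer.classicalTriple, Mayer.jetLift_zero] at h
      simpa only [add_sub_cancel, add_zero] using h
  -- The image of `u` is connected, so the component is the same at every time; this allows `w` to
  -- be fixed while `t` tends to `τ`.
  have hcomp : ∀ t ∈ Icc 0 T, w ∈ connectedComponentIn K (u t) := by
    intro t ht
    have hpre : IsPreconnected (u '' Icc 0 T) := isPreconnected_Icc.image _ hu.continuousOn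
    have hsub := hpre.subset_connectedComponentIn (mem_image_of_mem u hτ') huK.image_subset
    rwa [connectedComponentIn_eq (hsub (mem_image_of_mem u ht))] at hw
  have hinterior : ∀ t ∈ Ioo 0 T, ℓ t (f t (x t) w) ≤ ℓ t (f t (x t) (u t)) := by
    intro t ht
    have ht' := Ioo_subset_Icc_self ht
    obtain ⟨c, hc⟩ := hK.exists_isSmoothPathIn (huK ht') (hcomp t ht')
    have h := Mayer.le_of_needle_variations (G := fun t y v => f t (x t + y) v)
      (A := fun t y v => D t (x t + y) v) (J := fun y => C (x T + y)) (ℓ := ℓ) hK.isCompact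
      (hf.continuousOn.comp hframe hframe_maps)
      (fun s hs y v hv => by
        simpa using (hD s hs (x s + y) v hv).comp y
          ((hasFDerivAt_id (𝕜 := ℝ) y).const_add (x s)))
      (hDc.comp hframe hframe_maps) hu huK
      (fun s hs => by simpa only [add_zero] using hℓd s hs) hJ hvar ht hc
    simpa only [add_zero] using h
  -- Needles need room on both sides of `τ`, so the end point `T` is reached only as a limit.
  have hcl : closure (Ioo 0 T) = Icc 0 T := closure_Ioo hT.ne
  have hcont : ∀ v : ℝ → Fin M → ℝ, ContinuousOn v (Icc 0 T) → MapsTo v (Icc 0 T) K →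
      ContinuousOn (fun t => ℓ t (f t (x t) (v t))) (closure (Ioo 0 T)) := by
    intro v hv hvK
    rw [hcl]
    exact hℓc.clm_apply (hf.continuousOn.comp (f := fun t => (t, x t, v t))
      (continuousOn_id.prodMk (hxc.prodMk hv)) fun t ht => ⟨ht, mem_univ _, hvK ht⟩)
  rw [Mayer.pontryagin_eq_covector, Mayer.pontryagin_eq_covector]
  exact le_on_closure hinterior (hcont (fun _ => w) continuousOn_const fun _ _ => hwK)
    (hcont u hu.continuousOn huK) (hcl ▸ hτ')
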